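/- Let $Q_n$ denote the $n$-dimensional hypercube: its vertices are the $2^n$ binary $n$-tuples, and two vertices are adjacent when they differ in exactly one coordinate. A graph $H$ is said to decompose a graph $G$ if there are pairwise edge-disjoint subgraphs $H_1,\dots,H_k$ of $G$, each isomorphic to $H$, such that every edge of $G$ belongs to exactly one $H_i$. The path of length $r$ is the path with $r$ edges. Let $m\ge 1$ be an integer and let $n$ be an even integer with $n\ge 2^m$. Then, for each $r\in\{n,2n,4n,\dots,2^{m-1}n\}$ (that is, $r=2^j n$ with $0\le j\le m-1$), the path of length $r$ decomposes $Q_n$. -/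

import Mathlib

namespace CubeDecomposition

/-- The `n`-cube `Q_n`: vertices are the binary `n`-tuples, and two of them are adjacent when they
differ in exactly one coordinate. -/
def hypercube (n : ℕ) : SimpleGraph (Fin n → Bool) where
  Adj x y := ∃! i, x i ≠ y i
  symm := ⟨fun _ _ ⟨i, hi, hu⟩ => ⟨i, hi.symm, fun j hj => hu j hj.symm⟩⟩
  loopless := ⟨fun _ ⟨_, hi, _⟩ => hi rfl⟩

/-- A family of subgraphs of `G` is a decomposition of `G` when its members are pairwise
edge-disjoint and every edge of `G` belongs to exactly one of them. -/
def IsDecomposition {V ι : Type*} (G : SimpleGraph V) (F : ι → G.Subgraph) : Prop :=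
  (∀ i j, i ≠ j → Disjoint (F i).edgeSet (F j).edgeSet) ∧
    ∀ e ∈ G.edgeSet, ∃! i, e ∈ (F i).edgeSet

/-- The graph `H` decomposes `G`: there is a finite decomposition of `G` all of whose members are
isomorphic to `H`. -/
def Decomposes {W V : Type*} (H : SimpleGraph W) (G : SimpleGraph V) : Prop :=
  ∃ (k : ℕ) (F : Fin k → G.Subgraph),
    IsDecomposition G F ∧ ∀ i, Nonempty ((F i).coe ≃g H)

/-- The path of length `r`, that is, with `r` edges (and `r + 1` vertices). -/
abbrev pathOfLength (r : ℕ) : SimpleGraph (Fin (r + 1)) :=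
  SimpleGraph.pathGraph (r + 1)

end CubeDecomposition

open SimpleGraph

namespace CubeDecomposition

/-! Write `n = 2^(j+1) + 2d` and induct on `d`, with `k = 2^j` fixed.

For `d = 0`, the edges of the cube split into directed 2-factors whose cycle lengths are divisible
by `4^(j+1) = 2kn`, and every cycle is cut into arcs of length `kn`. Such 2-factors come from
doubling the dimension (`CycleFactorable.boxProd_self`): in `G □ G`, a cycle pair is traversed with
three steps in one coordinate for every step in the other.

For the step, `Q_(n+2)` is `Q_n □ C₄`. Each path is lifted to the four sheets and must gain `2k`
edges. By Hall's theorem each colour class of `Q_n` can be dealt out to the paths, `k` vertices to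
each (`exists_vertex_distribution`). At each of its `k` vertices a lift climbs two sheets
(`exists_detour_lift`). Lifts from even sheets use one colour, lifts from odd sheets the other, and
together they use every edge once. -/

/-! ### Path decompositions -/

/-- The edges of `G` can be partitioned into paths with `r` edges. -/
def PathDecomposable {V : Type} (G : SimpleGraph V) (r : ℕ) : Prop :=
  ∃ (ι : Type) (_ : Fintype ι) (a b : ι → V) (w : ∀ i, G.Walk (a i) (b i)),
    (∀ i, (w i).IsPath) ∧ (∀ i, (w i).length = r) ∧ ∀ e ∈ G.edgeSet, ∃! i, e ∈ (w i).edges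

theorem PathDecomposable.decomposes {V : Type} {G : SimpleGraph V} {r : ℕ}
    (h : PathDecomposable G r) : Decomposes (pathOfLength r) G := by
  obtain ⟨ι, _, a, b, w, hp, hl, he⟩ := h
  classical
  let φ := (Fintype.equivFin ι).symm
  refine ⟨Fintype.card ι, fun i => (w (φ i)).toSubgraph, ⟨?_, ?_⟩, ?_⟩
  · intro i j hij
    rw [Set.disjoint_left]
    intro e hi hj
    rw [Walk.mem_edges_toSubgraph] at hi hj
    exact hij (φ.injective ((he e ((w _).edges_subset_edgeSet hi)).unique hi hj))
  · intro e heG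
    obtain ⟨i, hi, hu⟩ := he e heG
    refine ⟨φ.symm i, (w _).mem_edges_toSubgraph.2 (by rwa [φ.apply_symm_apply]), fun j hj => ?_⟩
    rw [Equiv.eq_symm_apply]
    exact hu _ ((w _).mem_edges_toSubgraph.1 hj)
  · intro i
    have e := (hp (φ i)).pathGraphIsoToSubgraph
    rw [hl] at e
    exact ⟨e.symm⟩

theorem PathDecomposable.of_iso {V W : Type} {G : SimpleGraph V} {H : SimpleGraph W} {r : ℕ}
    (φ : G ≃g H) (h : PathDecomposable G r) : PathDecomposable H r := by
  obtain ⟨ι, _, a, b, w, hp, hl, he⟩ := h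
  refine ⟨ι, inferInstance, fun i => φ (a i), fun i => φ (b i), fun i => (w i).map φ.toHom,
    fun i => (hp i).map φ.injective, fun i => by simp [hl], ?_⟩
  intro e
  induction e with
  | h x y =>
    intro hxy
    have hxy' : s(φ.symm x, φ.symm y) ∈ G.edgeSet := by
      simpa [Iso.map_adj_iff] using hxy
    have key : ∀ i, s(x, y) ∈ ((w i).map φ.toHom).edges ↔
        s(φ.symm x, φ.symm y) ∈ (w i).edges := by
      intro i
      have : s(x, y) = Sym2.map φ.toHom s(φ.symm x, φ.symm y) := by simp
      rw [Walk.edges_map, this]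
      exact List.mem_map_of_injective (Sym2.map.injective φ.injective)
    simp_rw [key]
    exact he _ hxy'

/-! ### Directed 2-factors with clocks -/

/-- The walk that repeatedly applies a map sending every vertex to a neighbour. -/
def iterateWalk {V : Type} {G : SimpleGraph V} (f : V → V) (h : ∀ v, G.Adj v (f v)) :
    ∀ (t : ℕ) (v : V), G.Walk v (f^[t] v)
  | 0, _ => Walk.nil
  | t + 1, v => Walk.cons (h v) (iterateWalk f h t (f v))

section iterateWalk

variable {V : Type} {G : SimpleGraph V} {f : V → V} (h : ∀ v, G.Adj v (f v))

theorem length_iterateWalk (t : ℕ) (v : V) : (iterateWalk f h t v).length = t := by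
  induction t generalizing v with
  | zero => rfl
  | succ t ih => simp [iterateWalk, ih]

theorem mem_support_iterateWalk {t : ℕ} {v z : V} (hz : z ∈ (iterateWalk f h t v).support) :
    ∃ s ≤ t, z = f^[s] v := by
  induction t generalizing v with
  | zero => exact ⟨0, le_rfl, by simpa [iterateWalk] using hz⟩
  | succ t ih =>
    have hz' : z ∈ v :: (iterateWalk f h t (f v)).support := hz
    rcases List.mem_cons.1 hz' with rfl | hz'
    · exact ⟨0, by omega, rfl⟩
    · obtain ⟨s, hs, rfl⟩ := ih hz'
      exact ⟨s + 1, by omega, rfl⟩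

theorem mem_edges_iterateWalk {t : ℕ} {v : V} {e : Sym2 V} :
    e ∈ (iterateWalk f h t v).edges ↔ ∃ s < t, s(f^[s] v, f (f^[s] v)) = e := by
  induction t generalizing v with
  | zero => simp [iterateWalk]
  | succ t ih =>
    change e ∈ s(v, f v) :: (iterateWalk f h t (f v)).edges ↔ _
    rw [List.mem_cons, ih]
    constructor
    · rintro (rfl | ⟨s, hs, rfl⟩)
      · exact ⟨0, by omega, rfl⟩
      · exact ⟨s + 1, by omega, rfl⟩
    · rintro ⟨s, hs, rfl⟩
      cases s with
      | zero => exact Or.inl rfl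
      | succ s => exact Or.inr ⟨s, by omega, rfl⟩

theorem clock_iterate {L : ℕ} {θ : V → ℕ} (hθ : ∀ v, θ (f v) ≡ θ v + 1 [MOD L]) (s : ℕ) (v : V) :
    θ (f^[s] v) ≡ θ v + s [MOD L] := by
  induction s generalizing v with
  | zero => rfl
  | succ s ih =>
    have := (ih (f v)).trans ((hθ v).add_right s)
    rwa [show θ v + 1 + s = θ v + (s + 1) by omega] at this

/-- Returning to a vertex after `s + 1` steps would force `L ∣ s + 1`, which is impossible within
fewer than `L` steps. -/
theorem isPath_iterateWalk {L : ℕ} {θ : V → ℕ} (hθ : ∀ v, θ (f v) ≡ θ v + 1 [MOD L]) {t : ℕ}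
    (ht : t < L) (v : V) : (iterateWalk f h t v).IsPath := by
  induction t generalizing v with
  | zero => exact Walk.IsPath.nil
  | succ t ih =>
    refine (ih (by omega) (f v)).cons fun hv => ?_
    obtain ⟨s, hs, hv⟩ := mem_support_iterateWalk h hv
    have h1 := clock_iterate hθ (s + 1) v
    rw [Function.iterate_succ_apply, ← hv] at h1
    have h2 : 0 ≡ s + 1 [MOD L] := Nat.ModEq.add_left_cancel' (θ v) h1
    have h3 := (Nat.modEq_zero_iff_dvd.1 h2.symm)
    have := Nat.le_of_dvd (by omega) h3
    omega

end iterateWalk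

/-- The edges of `G` are partitioned into directed `2`-factors, each given by a successor map `f c`
together with a clock `θ c` which shows that all its cycles have length divisible by `L`. -/
def CycleFactorable {V : Type} (G : SimpleGraph V) (L : ℕ) : Prop :=
  ∃ (κ : Type) (_ : Fintype κ) (f : κ → V → V) (θ : κ → V → ℕ),
    (∀ c, Function.Bijective (f c)) ∧ (∀ c v, G.Adj v (f c v)) ∧
    (∀ c v, θ c (f c v) ≡ θ c v + 1 [MOD L]) ∧
    ∀ e ∈ G.edgeSet, ∃! q : κ × V, s(q.2, f q.1 q.2) = e

theorem CycleFactorable.of_iso {V W : Type} {G : SimpleGraph V} {H : SimpleGraph W} {L : ℕ}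
    (φ : G ≃g H) (h : CycleFactorable G L) : CycleFactorable H L := by
  obtain ⟨κ, _, f, θ, hf, ha, hθ, he⟩ := h
  refine ⟨κ, inferInstance, fun c v => φ (f c (φ.symm v)), fun c v => θ c (φ.symm v), ?_, ?_, ?_,
    ?_⟩
  · exact fun c => φ.bijective.comp ((hf c).comp φ.symm.bijective)
  · intro c v
    have := ha c (φ.symm v)
    rw [← φ.map_adj_iff] at this
    simpa using this
  · intro c v
    simpa using hθ c (φ.symm v)
  · intro e heH
    have heG : Sym2.map φ.symm e ∈ G.edgeSet := by
      induction e with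
      | h x y => simpa [Iso.map_adj_iff] using heH
    obtain ⟨⟨c, v⟩, hcv, hu⟩ := he _ heG
    refine ⟨(c, φ v), ?_, ?_⟩
    · apply Sym2.map.injective φ.symm.injective
      simpa using hcv
    · rintro ⟨c', v'⟩ h'
      have := hu (c', φ.symm v') (by simp [← h'])
      simp only [Prod.mk.injEq] at this ⊢
      exact ⟨this.1, by rw [← this.2]; simp⟩

/-- Cut every cycle where its clock is divisible by `r`. The modulus `2 * r`, rather than `r`,
guarantees that an arc of length `r` does not close up. -/
theorem CycleFactorable.pathDecomposable {V : Type} [Fintype V] {G : SimpleGraph V} {r : ℕ}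
    (hr : 0 < r) (h : CycleFactorable G (2 * r)) : PathDecomposable G r := by
  classical
  obtain ⟨κ, _, f, θ, hf, ha, hθ, he⟩ := h
  refine ⟨{q : κ × V // θ q.1 q.2 % r = 0}, inferInstance, fun q => q.1.2,
    fun q => (f q.1.1)^[r] q.1.2, fun q => iterateWalk _ (ha q.1.1) r q.1.2,
    fun q => isPath_iterateWalk _ (hθ _) (by omega) _, fun q => length_iterateWalk _ _ _, ?_⟩
  have clock : ∀ c s u, θ c ((f c)^[s] u) ≡ θ c u + s [MOD r] := fun c s u =>
    (clock_iterate (hθ c) s u).of_mul_left 2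
  intro e heG
  obtain ⟨⟨c, v⟩, hcv, hu⟩ := he e heG
  -- The arc through an edge starting at `v` begins `θ c v % r` steps before `v`.
  obtain ⟨u, huv⟩ := ((hf c).surjective.iterate (θ c v % r)) v
  have h1 := clock c (θ c v % r) u
  rw [huv] at h1
  have h0 : θ c u % r = 0 := by
    have : 0 + θ c v % r ≡ θ c u + θ c v % r [MOD r] := by
      rw [zero_add]
      exact (Nat.mod_modEq _ _).trans h1
    simpa [Nat.ModEq] using (Nat.ModEq.add_right_cancel' _ this).symm
  refine ⟨⟨(c, u), h0⟩, ?_, ?_⟩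
  · refine (mem_edges_iterateWalk _).2 ⟨θ c v % r, Nat.mod_lt _ hr, ?_⟩
    simpa [huv] using hcv
  · rintro ⟨⟨c', u'⟩, h0'⟩ h'
    obtain ⟨s, hs, hse⟩ := (mem_edges_iterateWalk _).1 h'
    have := hu (c', (f c')^[s] u') hse
    simp only [Prod.mk.injEq] at this
    obtain ⟨rfl, hv⟩ := this
    have h2 := clock c' s u'
    rw [hv] at h2
    have hs' : s = θ c' v % r := by
      have : θ c' u' + s ≡ 0 + s [MOD r] := Nat.ModEq.add_right s h0'
      have := h2.trans this
      rw [zero_add, Nat.ModEq, Nat.mod_eq_of_lt hs] at this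
      exact this.symm
    subst hs'
    have := (hf c').injective.iterate _ (hv.trans huv.symm)
    simpa using this

/-- The product of a graph with itself inherits a factorization with cycles four times as long. -/
theorem CycleFactorable.boxProd_self {V : Type} [Finite V] {G : SimpleGraph V} {L : ℕ}
    (hL : 4 ∣ L) (h : CycleFactorable G L) : CycleFactorable (G □ G) (4 * L) := by
  obtain ⟨κ, _, f, θ, hf, ha, hθ, he⟩ := h
  -- `P` says that the first coordinate moves. For `b = true` it moves unless the clock sum is 3 mod
  -- 4; for `b = false` the roles are exchanged. Every step raises the sum by one, so one move in
  -- four is in the slow coordinate.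
  let P : κ → Bool → V × V → Prop := fun c b q =>
    b = true ↔ (θ c q.1 + θ c q.2) % 4 ≠ 3
  have hθ4 : ∀ c v, θ c (f c v) % 4 = (θ c v + 1) % 4 := fun c v => (hθ c v).of_dvd hL
  classical
  let step : κ × Bool → V × V → V × V := fun q p =>
    if P q.1 q.2 p then (f q.1 p.1, p.2) else (p.1, f q.1 p.2)
  -- The new clock is four times the clock of the slow coordinate plus the sum mod 4: the slow
  -- coordinate advances exactly when the sum wraps from 3 to 0.
  refine ⟨κ × Bool, inferInstance, step, fun q p =>
    4 * θ q.1 (if q.2 then p.2 else p.1) + (θ q.1 p.1 + θ q.1 p.2) % 4, ?_, ?_, ?_, ?_⟩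
  · rintro ⟨c, b⟩
    rw [← Finite.surjective_iff_bijective]
    rintro ⟨x, y⟩
    obtain ⟨x', rfl⟩ := (hf c).surjective x
    obtain ⟨y', rfl⟩ := (hf c).surjective y
    have hx := hθ4 c x'
    have hy := hθ4 c y'
    -- The two candidate predecessors have the same clock sum mod 4, so `P` agrees on them and one
    -- of them steps to the target.
    by_cases hP : P c b (x', f c y')
    · exact ⟨(x', f c y'), by simp only [step, if_pos hP]⟩
    · refine ⟨(f c x', y'), ?_⟩
      have : ¬ P c b (f c x', y') := by
        simp only [P] at hP ⊢
        have : (θ c (f c x') + θ c y') % 4 = (θ c x' + θ c (f c y')) % 4 := by omega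
        rwa [this]
      simp only [step, if_neg this]
  · rintro ⟨c, b⟩ ⟨x, y⟩
    simp only [step]
    split_ifs
    · exact boxProd_adj_left.2 (ha c x)
    · exact boxProd_adj_right.2 (ha c y)
  · rintro ⟨c, b⟩ ⟨x, y⟩
    have hx := hθ4 c x
    have hy := hθ4 c y
    have hx4 := (hθ c x).mul_left' 4
    have hy4 := (hθ c y).mul_left' 4
    simp only [step, P]
    by_cases h3 : (θ c x + θ c y) % 4 = 3 <;> cases b <;> simp only [h3, ne_eq, not_true, not_false_iff,
      if_true, if_false, iff_true, iff_false, Bool.false_eq_true]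
    · have : (θ c (f c x) + θ c y) % 4 = 0 := by omega
      rw [this]
      simpa [mul_add, add_assoc] using hx4
    · have : (θ c x + θ c (f c y)) % 4 = 0 := by omega
      rw [this]
      simpa [mul_add, add_assoc] using hy4
    · have : (θ c x + θ c (f c y)) % 4 = (θ c x + θ c y) % 4 + 1 := by omega
      rw [this]
      exact Nat.ModEq.rfl
    · have : (θ c (f c x) + θ c y) % 4 = (θ c x + θ c y) % 4 + 1 := by omega
      rw [this]
      exact Nat.ModEq.rfl
  · intro e
    induction e with
    | h p q =>
      obtain ⟨x, y⟩ := p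
      obtain ⟨x', y'⟩ := q
      intro hadj
      rw [mem_edgeSet, boxProd_adj] at hadj
      rcases hadj with ⟨hadj, hy⟩ | ⟨hadj, hx⟩
      · dsimp only at hadj hy
        subst hy
        obtain ⟨⟨c, v⟩, hcv, hu⟩ := he s(x, x') hadj
        refine ⟨((c, decide ((θ c v + θ c y) % 4 ≠ 3)), (v, y)), ?_, ?_⟩
        · have hP : P c (decide ((θ c v + θ c y) % 4 ≠ 3)) (v, y) := decide_eq_true_iff
          simp only [step, if_pos hP]
          simpa using congrArg (Sym2.map fun z => (z, y)) hcv
        · rintro ⟨⟨c', b'⟩, v', z'⟩ h'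
          by_cases hP : P c' b' (v', z')
          · simp only [step, if_pos hP] at h'
            have h1 := congrArg (Sym2.map Prod.fst) h'
            have h2 := congrArg (Sym2.map Prod.snd) h'
            simp only [Sym2.map_mk] at h1 h2
            have h3 := hu (c', v') h1
            simp only [Prod.mk.injEq] at h3
            obtain ⟨rfl, rfl⟩ := h3
            obtain rfl : z' = y := by simpa using h2
            have : b' = decide ((θ c' v' + θ c' z') % 4 ≠ 3) := by
              rw [Bool.eq_iff_iff, decide_eq_true_iff]
              exact hP
            rw [this]
          · simp only [step, if_neg hP] at h'
            have h1 := congrArg (Sym2.map Prod.fst) h'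
            have : x = x' := by
              simp only [Sym2.map_mk, Sym2.eq_iff] at h1
              rcases h1 with ⟨h1, h2⟩ | ⟨h1, h2⟩
              · exact h1.symm.trans h2
              · exact h2.symm.trans h1
            exact absurd this hadj.ne
      · dsimp only at hadj hx
        subst hx
        obtain ⟨⟨c, v⟩, hcv, hu⟩ := he s(y, y') hadj
        refine ⟨((c, decide ((θ c x + θ c v) % 4 = 3)), (x, v)), ?_, ?_⟩
        · have hP : ¬ P c (decide ((θ c x + θ c v) % 4 = 3)) (x, v) := by
            simp only [P, decide_eq_true_iff]
            tauto
          simp only [step, if_neg hP]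
          simpa using congrArg (Sym2.map fun z => (x, z)) hcv
        · rintro ⟨⟨c', b'⟩, z', v'⟩ h'
          by_cases hP : P c' b' (z', v')
          · simp only [step, if_pos hP] at h'
            have h1 := congrArg (Sym2.map Prod.snd) h'
            have : y = y' := by
              simp only [Sym2.map_mk, Sym2.eq_iff] at h1
              rcases h1 with ⟨h1, h2⟩ | ⟨h1, h2⟩
              · exact h1.symm.trans h2
              · exact h2.symm.trans h1
            exact absurd this hadj.ne
          · simp only [step, if_neg hP] at h'
            have h1 := congrArg (Sym2.map Prod.snd) h'
            have h2 := congrArg (Sym2.map Prod.fst) h'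
            simp only [Sym2.map_mk] at h1 h2
            have h3 := hu (c', v') h1
            simp only [Prod.mk.injEq] at h3
            obtain ⟨rfl, rfl⟩ := h3
            obtain rfl : z' = x := by simpa using h2
            have : b' = decide ((θ c' z' + θ c' v') % 4 = 3) := by
              rw [Bool.eq_iff_iff, decide_eq_true_iff]
              simp only [P] at hP
              tauto
            rw [this]

/-- The cycle of length four on the integers modulo four. -/
def fourCycle : SimpleGraph (ZMod 4) where
  Adj x y := y = x + 1 ∨ x = y + 1
  symm := ⟨fun _ _ h => h.symm⟩
  loopless := ⟨by decide⟩

theorem fourCycle_adj_add_one (σ : ZMod 4) : fourCycle.Adj σ (σ + 1) := Or.inl rfl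

/-! ### Lifting paths with detours -/

/-- A path in `G` lifts to paths in `G □ fourCycle`, one from each sheet, which move two sheets up
at every vertex of `D` and do not change the sheet elsewhere. -/
theorem exists_detour_lift {V : Type} {G : SimpleGraph V} (D : V → Prop) [DecidablePred D]
    {u v : V} (w : G.Walk u v) (hw : w.IsPath) :
    ∃ (ε : ZMod 4 → ZMod 4) (W : ∀ σ, (G □ fourCycle).Walk (u, σ) (v, ε σ)),
      (∀ σ, (W σ).IsPath) ∧
      (∀ σ, (W σ).length = w.length + 2 * (w.support.filter D).length) ∧
      (∀ σ, ∀ z ∈ (W σ).support, z.1 ∈ w.support) ∧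
      (∀ x y, s(x, y) ∈ w.edges → ∃ t : ZMod 4, (t = 0 ∨ t = 2) ∧
        ∀ σ γ, s((x, γ), (y, γ)) ∈ (W σ).edges ↔ γ = σ + t) ∧
      (∀ σ γ x y, x ≠ y → s((x, γ), (y, γ)) ∈ (W σ).edges → s(x, y) ∈ w.edges) ∧
      (∀ x ∈ w.support, D x → ∃ t : ZMod 4, (t = 0 ∨ t = 2) ∧
        ∀ σ γ, s((x, γ), (x, γ + 1)) ∈ (W σ).edges ↔ γ = σ + t ∨ γ = σ + t + 1) ∧
      (∀ σ γ x, s((x, γ), (x, γ + 1)) ∈ (W σ).edges → x ∈ w.support ∧ D x) := by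
  have h2 : ∀ t : ZMod 4, t = 0 ∨ t = 2 → 2 + t = 0 ∨ 2 + t = 2 := by decide
  have e1 : ∀ σ γ : ZMod 4, (γ = σ ∧ γ + 1 = σ + 1 ∨ γ = σ + 1 ∧ γ + 1 = σ) ↔ γ = σ := by decide
  have e2 : ∀ σ γ : ZMod 4, (γ = σ + 1 ∧ γ + 1 = σ + 2 ∨ γ = σ + 2 ∧ γ + 1 = σ + 1) ↔
      γ = σ + 1 := by decide
  have d1 : ∀ σ : ZMod 4, σ ≠ σ + 1 := by decide
  have d2 : ∀ σ : ZMod 4, σ ≠ σ + 2 := by decide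
  have d3 : ∀ σ : ZMod 4, σ + 1 ≠ σ + 2 := by decide
  have a2 : ∀ σ : ZMod 4, fourCycle.Adj (σ + 1) (σ + 2) := fun σ => Or.inl (by ring)
  -- The shift `t` is twice the number of detours made earlier on the path, mod 4; it does not
  -- depend on the starting sheet.
  induction w with
  | nil =>
    rename_i u
    by_cases hD : D u
    · refine ⟨fun σ => σ + 2, fun σ =>
        .cons (boxProd_adj_right.2 (fourCycle_adj_add_one σ)) (.cons (boxProd_adj_right.2 (a2 σ)) .nil),
        ?_, ?_, ?_, ?_, ?_, ?_, ?_⟩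
      · intro σ
        simp [Walk.cons_isPath_iff, d1, d2, d3]
      · simp [hD]
      · simp
      · simp
      · intro σ γ x y hxy
        simp only [Walk.edges_cons, Walk.edges_nil, List.mem_cons, Sym2.eq_iff, Prod.mk.injEq,
          List.not_mem_nil, or_false]
        rintro (h | h) <;> exact absurd (by rcases h with ⟨⟨h, -⟩, h', -⟩ | ⟨⟨h, -⟩, h', -⟩ <;> exact h.trans h'.symm) hxy
      · intro x hx _
        obtain rfl : x = u := by simpa using hx
        refine ⟨0, Or.inl rfl, fun σ γ => ?_⟩
        simp only [Walk.edges_cons, Walk.edges_nil, List.mem_cons, Sym2.eq_iff, Prod.mk.injEq,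
          List.not_mem_nil, or_false, true_and, e1, e2, add_zero]
      · intro σ γ x hx
        have := Walk.fst_mem_support_of_mem_edges _ hx
        obtain rfl : x = u := by
          simp at this
          tauto
        simp [hD]
    · refine ⟨fun σ => σ, fun σ => .nil, ?_, ?_, ?_, ?_, ?_, ?_, ?_⟩ <;> simp [hD]
  | cons h w' ih =>
    rename_i u u' v
    rw [Walk.cons_isPath_iff] at hw
    obtain ⟨hw', hu⟩ := hw
    obtain ⟨ε, W, hP, hl, hs, hh, hh', hv, hv'⟩ := ih hw'
    have hnot : ∀ σ γ, (u, γ) ∉ (W σ).support := fun σ γ hm => hu (hs σ _ hm)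
    have hnote : ∀ σ γ z, s((u, γ), z) ∉ (W σ).edges := fun σ γ z hm =>
      hnot σ γ (Walk.fst_mem_support_of_mem_edges _ hm)
    have hnote' : ∀ σ γ z, s(z, (u, γ)) ∉ (W σ).edges := fun σ γ z hm =>
      hnot σ γ (Walk.snd_mem_support_of_mem_edges _ hm)
    have huu' : u ≠ u' := h.ne
    by_cases hD : D u
    -- Climb over `u` first, then cross to `u'` in sheet `σ + 2`, so all later shifts grow by 2.
    · refine ⟨fun σ => ε (σ + 2), fun σ =>
        .cons (boxProd_adj_right.2 (fourCycle_adj_add_one σ)) (.cons (boxProd_adj_right.2 (a2 σ))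
        (.cons (boxProd_adj_left.2 h) (W (σ + 2)))), ?_, ?_, ?_, ?_, ?_, ?_, ?_⟩
      · intro σ
        simp [Walk.cons_isPath_iff, d1, d2, d3, hP, hnot]
      · intro σ
        simp [hD, hl]
        ring
      · intro σ z hz
        simp only [Walk.support_cons, List.mem_cons] at hz ⊢
        rcases hz with rfl | rfl | rfl | hz
        · exact Or.inl rfl
        · exact Or.inl rfl
        · exact Or.inl rfl
        · exact Or.inr (hs _ _ hz)
      · intro x y hxy
        rw [Walk.edges_cons, List.mem_cons] at hxy
        rcases hxy with hxy | hxy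
        · refine ⟨2, Or.inr rfl, fun σ γ => ?_⟩
          rcases Sym2.eq_iff.1 hxy with ⟨rfl, rfl⟩ | ⟨rfl, rfl⟩
          · simp [hnote, huu'.symm]
          · simp [hnote', huu'.symm]
        · obtain ⟨t, ht, hW⟩ := hh x y hxy
          refine ⟨2 + t, h2 t ht, fun σ γ => ?_⟩
          have hx : x ≠ u := fun hx => hu (hx ▸ Walk.fst_mem_support_of_mem_edges _ hxy)
          have hy : y ≠ u := fun hx => hu (hx ▸ Walk.snd_mem_support_of_mem_edges _ hxy)
          simp [hW, hx, hy, add_assoc]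
      · intro σ γ x y hxy hm
        simp only [Walk.edges_cons, List.mem_cons] at hm ⊢
        rcases hm with hm | hm | hm | hm
        · simp only [Sym2.eq_iff, Prod.mk.injEq] at hm
          exact absurd (by rcases hm with ⟨⟨h, -⟩, h', -⟩ | ⟨⟨h, -⟩, h', -⟩ <;> exact h.trans h'.symm) hxy
        · simp only [Sym2.eq_iff, Prod.mk.injEq] at hm
          exact absurd (by rcases hm with ⟨⟨h, -⟩, h', -⟩ | ⟨⟨h, -⟩, h', -⟩ <;> exact h.trans h'.symm) hxy
        · exact Or.inl (by simpa using congrArg (Sym2.map Prod.fst) hm)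
        · exact Or.inr (hh' _ _ _ _ hxy hm)
      · intro x hx hDx
        rw [Walk.support_cons, List.mem_cons] at hx
        by_cases hxu : x = u
        · subst hxu
          refine ⟨0, Or.inl rfl, fun σ γ => ?_⟩
          simp [hnote, huu']
          revert σ γ
          decide
        · obtain ⟨t, ht, hW⟩ := hv x (hx.resolve_left hxu) hDx
          refine ⟨2 + t, h2 t ht, fun σ γ => ?_⟩
          simp [hW, hxu, add_assoc]
      · intro σ γ x hm
        by_cases hxu : x = u
        · subst hxu
          simp [hD]
        · have : s((x, γ), (x, γ + 1)) ∈ (W (σ + 2)).edges := by simpa [hxu] using hm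
          have := hv' _ _ _ this
          exact ⟨by simp [this.1], this.2⟩
    · refine ⟨fun σ => ε σ, fun σ => .cons (boxProd_adj_left.2 h) (W σ), ?_, ?_, ?_, ?_, ?_, ?_, ?_⟩
      · intro σ
        simp [Walk.cons_isPath_iff, hP, hnot]
      · intro σ
        simp [hD, hl]
        ring
      · intro σ z hz
        simp only [Walk.support_cons, List.mem_cons] at hz ⊢
        rcases hz with rfl | hz
        · exact Or.inl rfl
        · exact Or.inr (hs _ _ hz)
      · intro x y hxy
        rw [Walk.edges_cons, List.mem_cons] at hxy
        rcases hxy with hxy | hxy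
        · refine ⟨0, Or.inl rfl, fun σ γ => ?_⟩
          rcases Sym2.eq_iff.1 hxy with ⟨rfl, rfl⟩ | ⟨rfl, rfl⟩
          · simp [hnote, huu'.symm]
          · simp [hnote', huu'.symm]
        · obtain ⟨t, ht, hW⟩ := hh x y hxy
          refine ⟨t, ht, fun σ γ => ?_⟩
          have hx : x ≠ u := fun hx => hu (hx ▸ Walk.fst_mem_support_of_mem_edges _ hxy)
          have hy : y ≠ u := fun hx => hu (hx ▸ Walk.snd_mem_support_of_mem_edges _ hxy)
          simp [hW, hx, hy]
      · intro σ γ x y hxy hm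
        simp only [Walk.edges_cons, List.mem_cons] at hm ⊢
        rcases hm with hm | hm
        · exact Or.inl (by simpa using congrArg (Sym2.map Prod.fst) hm)
        · exact Or.inr (hh' _ _ _ _ hxy hm)
      · intro x hx hDx
        have hxu : x ≠ u := by rintro rfl; exact hD hDx
        rw [Walk.support_cons, List.mem_cons] at hx
        obtain ⟨t, ht, hW⟩ := hv x (hx.resolve_left hxu) hDx
        refine ⟨t, ht, fun σ γ => ?_⟩
        simp [hW, hxu]
      · intro σ γ x hm
        have : s((x, γ), (x, γ + 1)) ∈ (W σ).edges := by
          rw [Walk.edges_cons, List.mem_cons] at hm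
          refine hm.resolve_left fun hm => ?_
          have := congrArg (Sym2.map Prod.fst) hm
          simp only [Sym2.map_mk, Sym2.eq_iff] at this
          rcases this with ⟨h1, h2⟩ | ⟨h1, h2⟩
          · exact huu' (h1.symm.trans h2)
          · exact huu' (h2.symm.trans h1)
        have := hv' _ _ _ this
        exact ⟨by simp [this.1], this.2⟩

/-! ### Hypercubes -/

theorem hypercube_adj_iff {n : ℕ} {x y : Fin n → Bool} :
    (hypercube n).Adj x y ↔ ∃ i, y = Function.update x i (!x i) := by
  constructor
  · rintro ⟨i, hi, hu⟩
    refine ⟨i, funext fun j => ?_⟩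
    by_cases h : j = i
    · subst h
      simpa [Bool.eq_not, eq_comm] using hi
    · simpa [h, eq_comm] using mt (hu j) h
  · rintro ⟨i, rfl⟩
    refine ⟨i, by simp, fun j hj => ?_⟩
    by_contra h
    simp [h] at hj

theorem hypercube_degree (n : ℕ) (x : Fin n → Bool) [Fintype ((hypercube n).neighborSet x)] :
    (hypercube n).degree x = n := by
  classical
  have : (hypercube n).neighborFinset x =
      Finset.univ.image fun i => Function.update x i (!x i) := by
    ext y
    simp [hypercube_adj_iff, eq_comm]
  rw [← card_neighborFinset_eq_degree, this, Finset.card_image_of_injective, Finset.card_univ,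
    Fintype.card_fin]
  intro i j hij
  by_contra h
  have := congrFun hij i
  simp [h] at this

theorem exists_hypercube_coloring (n : ℕ) :
    ∃ col : (Fin n → Bool) → Bool, ∀ x y, (hypercube n).Adj x y → col x ≠ col y := by
  refine ⟨fun x => decide (∑ i, (if x i then 1 else 0 : ZMod 2) = 0), fun x y h => ?_⟩
  obtain ⟨i, rfl⟩ := hypercube_adj_iff.1 h
  have e : ∀ z : Fin n → Bool, ∑ i, (if z i then 1 else 0 : ZMod 2) =
      (if z i then 1 else 0) + ∑ j ∈ Finset.univ.erase i, (if z j then 1 else 0 : ZMod 2) :=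
    fun z => (Finset.add_sum_erase _ _ (Finset.mem_univ i)).symm
  have e' : ∑ j ∈ Finset.univ.erase i, (if Function.update x i (!x i) j then 1 else 0 : ZMod 2) =
      ∑ j ∈ Finset.univ.erase i, (if x j then 1 else 0 : ZMod 2) :=
    Finset.sum_congr rfl fun j hj => by simp [Finset.ne_of_mem_erase hj]
  beta_reduce
  rw [e, e (Function.update x i _), e', Function.update_self]
  generalize ∑ j ∈ Finset.univ.erase i, (if x j then 1 else 0 : ZMod 2) = c
  generalize x i = b
  revert b c
  decide

/-- The product of two cubes is a cube. -/
def hypercubeAppend (m n : ℕ) : ((hypercube m).boxProd (hypercube n)) ≃g hypercube (m + n) where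
  toEquiv := Fin.appendEquiv m n
  map_rel_iff' := by
    rintro ⟨x, y⟩ ⟨x', y'⟩
    have hl : ∀ i, Function.update (Fin.append x y) (Fin.castAdd n i) (!x i) =
        Fin.append (Function.update x i (!x i)) y := fun i => by
      ext j
      induction j using Fin.addCases <;> simp [Function.update_apply, Fin.ext_iff]
      omega
    have hr : ∀ i, Function.update (Fin.append x y) (Fin.natAdd m i) (!y i) =
        Fin.append x (Function.update y i (!y i)) := fun i => by
      ext j
      induction j using Fin.addCases <;> simp [Function.update_apply, Fin.ext_iff]
      omega
    have hinj : ∀ u v, Fin.append x' y' = Fin.append u v ↔ x' = u ∧ y' = v := fun u v => by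
      exact ((Fin.appendEquiv m n).injective.eq_iff (a := (x', y')) (b := (u, v))).trans
        Prod.mk_inj
    simp only [boxProd_adj, hypercube_adj_iff, Fin.appendEquiv, Equiv.coe_fn_mk]
    constructor
    · rintro ⟨i, hi⟩
      induction i using Fin.addCases with
      | left i =>
        rw [Fin.append_left, hl, hinj] at hi
        exact Or.inl ⟨⟨i, hi.1⟩, hi.2.symm⟩
      | right i =>
        rw [Fin.append_right, hr, hinj] at hi
        exact Or.inr ⟨⟨i, hi.2⟩, hi.1.symm⟩
    · rintro (⟨⟨i, rfl⟩, rfl⟩ | ⟨⟨i, rfl⟩, rfl⟩)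
      · exact ⟨Fin.castAdd n i, by rw [Fin.append_left, hl]⟩
      · exact ⟨Fin.natAdd m i, by rw [Fin.append_right, hr]⟩

/-- The two-dimensional cube is a cycle of length four. -/
def hypercubeTwo : hypercube 2 ≃g fourCycle where
  toFun x := if x 0 then (if x 1 then 2 else 1) else (if x 1 then 3 else 0)
  invFun σ := ![decide (σ = 1 ∨ σ = 2), decide (σ = 2 ∨ σ = 3)]
  left_inv := by decide
  right_inv := by decide
  map_rel_iff' := by
    intro x y
    rw [hypercube_adj_iff]
    simp only [fourCycle]
    revert x y
    decide

/-- `Q_2` is itself a 4-cycle; each doubling of the dimension multiplies the modulus by 4. -/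
theorem cycleFactorable_hypercube (m : ℕ) :
    CycleFactorable (hypercube (2 ^ (m + 1))) (4 ^ (m + 1)) := by
  induction m with
  | zero =>
    refine CycleFactorable.of_iso hypercubeTwo.symm
      ⟨Unit, inferInstance, fun _ σ => σ + 1, fun _ σ => σ.val, fun _ => ?_, fun _ σ => ?_, ?_, ?_⟩
    · exact (Equiv.addRight (1 : ZMod 4)).bijective
    · exact fourCycle_adj_add_one σ
    · have : ∀ σ : ZMod 4, (σ + 1).val ≡ σ.val + 1 [MOD 4] := by decide
      exact fun _ => this
    · intro e
      induction e with
      | h x y =>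
        intro h
        rcases h with h | h
        · dsimp only at h
          subst h
          refine ⟨((), x), rfl, ?_⟩
          rintro ⟨_, z⟩ hz
          have : ∀ x z : ZMod 4, (s(z, z + 1) = s(x, x + 1)) → z = x := by decide
          exact Prod.ext rfl (this _ _ hz)
        · dsimp only at h
          subst h
          refine ⟨((), y), Sym2.eq_swap, ?_⟩
          rintro ⟨_, z⟩ hz
          have : ∀ x z : ZMod 4, (s(z, z + 1) = s(x + 1, x)) → z = x := by decide
          exact Prod.ext rfl (this _ _ hz)
  | succ m ih =>
    have := (ih.boxProd_self (dvd_pow_self 4 (Nat.succ_ne_zero m))).of_iso (hypercubeAppend _ _)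
    rwa [← two_mul, ← pow_succ', ← pow_succ'] at this

/-! ### Raising the dimension by two -/

/-- In a regular bipartite graph that is partitioned into paths
with `k * n` edges, the vertices of one colour can be distributed among the paths, `k` vertices to
each path, so that every path gets vertices it passes through. -/
theorem exists_vertex_distribution {V ι : Type} [Fintype V] [Fintype ι] {G : SimpleGraph V}
    {n k : ℕ} (hn : 0 < n)
    (hdeg : ∀ (v : V) [Fintype (G.neighborSet v)], G.degree v = n)
    {col : V → Bool} (hcol : ∀ x y, G.Adj x y → col x ≠ col y)
    {a b : ι → V} (w : ∀ i, G.Walk (a i) (b i)) (hp : ∀ i, (w i).IsPath)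
    (hl : ∀ i, (w i).length = k * n) (he : ∀ e ∈ G.edgeSet, ∃! i, e ∈ (w i).edges) (c : Bool) :
    ∃ g : ι × Fin k → V, Function.Injective g ∧ (∀ q, g q ∈ (w q.1).support) ∧
      ∀ v, col v = c ↔ ∃ q, g q = v := by
  classical
  let E : ι → Finset (Sym2 V) := fun i => (w i).edges.toFinset
  have hE : ∀ i, (E i).card = k * n := fun i => by
    rw [List.toFinset_card_of_nodup (hp i).isTrail.edges_nodup, Walk.length_edges, hl]
  have hdisj : ∀ i j, i ≠ j → Disjoint (E i) (E j) := fun i j hij => by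
    rw [Finset.disjoint_left]
    intro e hi hj
    rw [List.mem_toFinset] at hi hj
    exact hij ((he e ((w i).edges_subset_edgeSet hi)).unique hi hj)
  have hEcard : ∀ I : Finset ι, (I.biUnion E).card = I.card * (k * n) := fun I => by
    rw [Finset.card_biUnion fun i _ j _ hij => hdisj i j hij]
    simp [hE]
  let t : ι × Fin k → Finset V := fun q => (w q.1).support.toFinset.filter fun v => col v = c
  -- Hall's condition: `S` meets at least `|S| / k` paths, which have at least `|S| * n` edges. Each
  -- edge has an endpoint of colour `c` on its path, and a vertex accounts for only `n` edges.
  have hall : ∀ S : Finset (ι × Fin k), S.card ≤ (S.biUnion t).card := by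
    intro S
    have h1 : S.card ≤ (S.image Prod.fst).card * k := by
      have : S ⊆ (S.image Prod.fst) ×ˢ (Finset.univ : Finset (Fin k)) := fun q hq =>
        Finset.mem_product.2 ⟨Finset.mem_image_of_mem _ hq, Finset.mem_univ _⟩
      simpa using Finset.card_le_card this
    have h2 : (S.image Prod.fst).biUnion E ⊆ (S.biUnion t).biUnion fun v => G.incidenceFinset v := by
      intro e hmem
      simp only [Finset.mem_biUnion, Finset.mem_image] at hmem
      obtain ⟨_, ⟨q, hq, rfl⟩, hqe⟩ := hmem
      rw [List.mem_toFinset] at hqe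
      have hG := (w q.1).edges_subset_edgeSet hqe
      induction e with
      | h x y =>
        simp only [Finset.mem_biUnion, mem_incidenceFinset]
        by_cases hx : col x = c
        · exact ⟨x, ⟨q, hq, by simp [t, hx, Walk.fst_mem_support_of_mem_edges _ hqe]⟩, hG, by simp⟩
        · have hy : col y = c := by
            have := hcol x y hG
            revert hx this
            cases col x <;> cases col y <;> cases c <;> simp
          exact ⟨y, ⟨q, hq, by simp [t, hy, Walk.snd_mem_support_of_mem_edges _ hqe]⟩, hG, by simp⟩
    have h3 := Finset.card_le_card h2
    rw [hEcard] at h3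
    have h4 : ((S.biUnion t).biUnion fun v => G.incidenceFinset v).card ≤ (S.biUnion t).card * n :=
      Finset.card_biUnion_le_card_mul _ _ _ fun v _ => by
        rw [card_incidenceFinset_eq_degree, hdeg]
    rw [← mul_assoc] at h3
    exact h1.trans (Nat.le_of_mul_le_mul_right (h3.trans h4) hn)
  obtain ⟨g, hg, hgt⟩ := (Finset.all_card_le_biUnion_card_iff_exists_injective t).1 hall
  have hgt' : ∀ q, g q ∈ (w q.1).support ∧ col (g q) = c := fun q => by simpa [t] using hgt q
  refine ⟨g, hg, fun q => (hgt' q).1, fun v => ⟨?_, by rintro ⟨q, rfl⟩; exact (hgt' q).2⟩⟩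
  have hsub : Finset.univ.image g ⊆ Finset.univ.filter fun v => col v = c := by
    intro v hv
    simp only [Finset.mem_image, Finset.mem_univ, true_and] at hv
    obtain ⟨q, rfl⟩ := hv
    simpa using (hgt' q).2
  -- Edges at distinct vertices of colour `c` are distinct, so the class has at most as many
  -- vertices as there are slots, and `g` fills it.
  have hcard : (Finset.univ.filter fun v => col v = c).card ≤ (Finset.univ.image g).card := by
    rw [Finset.card_image_of_injective _ hg, Finset.card_univ, Fintype.card_prod, Fintype.card_fin]
    have h1 : ((Finset.univ.filter fun v => col v = c).biUnion fun v => G.incidenceFinset v).card =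
        (Finset.univ.filter fun v => col v = c).card * n := by
      rw [Finset.card_biUnion]
      · simp [hdeg]
      · intro x hx y hy hxy
        refine Finset.disjoint_left.2 ?_
        intro e hex hey
        rw [mem_incidenceFinset] at hex hey
        have hx : col x = c := by simpa using hx
        have hy : col y = c := by simpa using hy
        have := (Sym2.mem_and_mem_iff hxy).1 ⟨hex.2, hey.2⟩
        subst this
        exact hcol x y hex.1 (hx.trans hy.symm)
    have h2 : ((Finset.univ.filter fun v => col v = c).biUnion fun v => G.incidenceFinset v) ⊆
        Finset.univ.biUnion E := by
      intro e hmem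
      simp only [Finset.mem_biUnion, mem_incidenceFinset] at hmem
      obtain ⟨v, -, hv⟩ := hmem
      obtain ⟨i, hi, -⟩ := he e hv.1
      exact Finset.mem_biUnion.2 ⟨i, Finset.mem_univ _, List.mem_toFinset.2 hi⟩
    have h3 := Finset.card_le_card h2
    rw [h1, hEcard, ← mul_assoc, Finset.card_univ] at h3
    exact Nat.le_of_mul_le_mul_right h3 hn
  intro hv
  have : v ∈ Finset.univ.image g := by
    rw [Finset.eq_of_subset_of_card_le hsub hcard]
    simpa using hv
  simpa using this

/-- Replacing the second factor of a product by an isomorphic graph. -/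
def boxProdCongrRight {V W W' : Type} (G : SimpleGraph V) {H : SimpleGraph W} {H' : SimpleGraph W'}
    (φ : H ≃g H') : (G.boxProd H) ≃g (G.boxProd H') where
  toEquiv := Equiv.prodCongrRight fun _ => φ.toEquiv
  map_rel_iff' := by
    rintro ⟨x, y⟩ ⟨x', y'⟩
    simp [boxProd_adj, Iso.map_adj_iff]

/-- Lengthening every path by `2 * k` edges when the degree grows by two. -/
theorem PathDecomposable.boxProd_fourCycle {V : Type} [Fintype V] {G : SimpleGraph V}
    {n k : ℕ} (hn : 0 < n) (hdeg : ∀ (v : V) [Fintype (G.neighborSet v)], G.degree v = n)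
    {col : V → Bool} (hcol : ∀ x y, G.Adj x y → col x ≠ col y)
    (h : PathDecomposable G (k * n)) : PathDecomposable (G □ fourCycle) (k * (n + 2)) := by
  classical
  obtain ⟨ι, _, a, b, w, hp, hl, he⟩ := h
  choose g hg hgs hgc using exists_vertex_distribution hn hdeg hcol w hp hl he
  -- The parity of the starting sheet selects the colour at which a lift detours. Shifts are even,
  -- so horizontal edges stay in sheets of that parity.
  let par : ZMod 4 → Bool := fun σ => decide (σ = 1 ∨ σ = 3)
  have par_add : ∀ σ t : ZMod 4, (t = 0 ∨ t = 2) → par (σ + t) = par σ := by decide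
  have par_sub : ∀ σ t : ZMod 4, (t = 0 ∨ t = 2) → par (σ - t) = par σ := by decide
  -- The two starting sheets of one parity differ by 2, so their climbs at a vertex together cover
  -- its vertical 4-cycle once.
  have par_unique : ∀ (t γ : ZMod 4) (c : Bool), (t = 0 ∨ t = 2) →
      ∃ σ, (par σ = c ∧ (γ = σ + t ∨ γ = σ + t + 1)) ∧
        ∀ σ', par σ' = c ∧ (γ = σ' + t ∨ γ = σ' + t + 1) → σ' = σ := by decide
  let D : ι → Bool → V → Prop := fun i c v => ∃ s, g c (i, s) = v
  choose ε W hWp hWl hWs hh hh' hv hv' using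
    fun i c => exists_detour_lift (D i c) (w i) (hp i)
  have hD : ∀ i c, ((w i).support.filter (D i c)).length = k := by
    intro i c
    rw [← List.toFinset_card_of_nodup ((hp i).support_nodup.filter _)]
    have : ((w i).support.filter (D i c)).toFinset = Finset.univ.image fun s => g c (i, s) := by
      ext v
      simp only [List.mem_toFinset, List.mem_filter, decide_eq_true_eq, Finset.mem_image,
        Finset.mem_univ, true_and, D]
      refine ⟨fun h => h.2, fun h => ⟨?_, h⟩⟩
      obtain ⟨s, rfl⟩ := h
      exact hgs c (i, s)
    rw [this, Finset.card_image_of_injective, Finset.card_univ, Fintype.card_fin]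
    intro s s' hss
    simpa using hg c hss
  refine ⟨ι × ZMod 4, inferInstance, fun q => (a q.1, q.2), fun q => (b q.1, ε q.1 (par q.2) q.2),
    fun q => W q.1 (par q.2) q.2, fun q => hWp _ _ _, fun q => ?_, ?_⟩
  · rw [hWl, hl, hD]
    ring
  have vertical : ∀ x γ, ∃! q : ι × ZMod 4, s((x, γ), (x, γ + 1)) ∈ (W q.1 (par q.2) q.2).edges := by
    intro x γ
    obtain ⟨⟨i, s⟩, his⟩ := (hgc (col x) x).1 rfl
    obtain ⟨t, ht, hW⟩ := hv i (col x) x (by simpa [his] using hgs (col x) (i, s)) ⟨s, his⟩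
    obtain ⟨σ, ⟨hσ, hσγ⟩, hu⟩ := par_unique t γ (col x) ht
    refine ⟨(i, σ), ?_, ?_⟩
    · dsimp only
      rw [hσ, hW]
      exact hσγ
    · rintro ⟨i', σ'⟩ h'
      obtain ⟨-, s', hs'⟩ := hv' _ _ _ _ _ h'
      have hpar : par σ' = col x := ((hgc _ _).2 ⟨_, hs'⟩).symm
      rw [hpar] at hs'
      have := hg _ (hs'.trans his.symm)
      obtain ⟨rfl, rfl⟩ := Prod.mk.inj this
      dsimp only at h'
      rw [hpar, hW] at h'
      rw [hu σ' ⟨hpar, h'⟩]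
  have horizontal : ∀ x y γ, G.Adj x y →
      ∃! q : ι × ZMod 4, s((x, γ), (y, γ)) ∈ (W q.1 (par q.2) q.2).edges := by
    intro x y γ hxy
    obtain ⟨i, hi, hiu⟩ := he s(x, y) hxy
    obtain ⟨t, ht, hW⟩ := hh i (par γ) x y hi
    refine ⟨(i, γ - t), ?_, ?_⟩
    · dsimp only
      rw [par_sub _ _ ht, hW, sub_add_cancel]
    · rintro ⟨i', σ'⟩ h'
      obtain rfl := hiu i' (hh' _ _ _ _ _ _ hxy.ne h')
      obtain ⟨t', ht', hW'⟩ := hh i' (par σ') x y hi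
      have hpar : par σ' = par γ := by
        rw [(hW' _ _).1 h', par_add _ _ ht']
      dsimp only at h'
      rw [hpar, hW] at h'
      rw [h', add_sub_cancel_right]
  intro e
  induction e with
  | h p q =>
    obtain ⟨x, γ⟩ := p
    obtain ⟨y, δ⟩ := q
    intro hadj
    rw [mem_edgeSet, boxProd_adj] at hadj
    dsimp only at hadj
    rcases hadj with ⟨hadj, rfl⟩ | ⟨rfl | rfl, rfl⟩
    · exact horizontal x y γ hadj
    · exact vertical x γ
    · rw [Sym2.eq_swap]
      exact vertical x δ

theorem pathDecomposable_hypercube (m d : ℕ) :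
    PathDecomposable (hypercube (2 ^ (m + 1) + 2 * d)) (2 ^ m * (2 ^ (m + 1) + 2 * d)) := by
  induction d with
  | zero =>
    -- The path length is half of `4 ^ (m + 1)`, as cutting the cycles requires.
    have h : 2 * (2 ^ m * (2 ^ (m + 1) + 2 * 0)) = 4 ^ (m + 1) := by
      rw [show 4 = 2 * 2 by rfl, mul_pow]
      ring
    exact CycleFactorable.pathDecomposable (by positivity) (h ▸ cycleFactorable_hypercube m)
  | succ d ih =>
    obtain ⟨col, hcol⟩ := exists_hypercube_coloring (2 ^ (m + 1) + 2 * d)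
    have h := ih.boxProd_fourCycle (by positivity) (fun v _ => hypercube_degree _ v) hcol
    exact (h.of_iso (boxProdCongrRight _ hypercubeTwo.symm)).of_iso (hypercubeAppend _ 2)

end CubeDecomposition

theorem corollary1p3 (n m : ℕ) (hn : Even n) (hm : 1 ≤ m) (hnm : 2 ^ m ≤ n) :
    ∀ j : ℕ, j ≤ m - 1 →
      CubeDecomposition.Decomposes (CubeDecomposition.pathOfLength (2 ^ j * n))
        (CubeDecomposition.hypercube n) := by
  intro j hj
  have hjn : 2 ^ (j + 1) ≤ n := (Nat.pow_le_pow_right two_pos (by omega)).trans hnm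
  obtain ⟨d, rfl⟩ : ∃ d, n = 2 ^ (j + 1) + 2 * d := by
    obtain ⟨e, rfl⟩ := hn
    rw [pow_succ] at hjn ⊢
    exact ⟨e - 2 ^ j, by omega⟩
  exact (CubeDecomposition.pathDecomposable_hypercube j d).decomposes
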